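/- Let $\mathcal A$ be a unital $C^*$-algebra and let $H_{\mathcal A}$ be the standard (right) Hilbert $\mathcal A$-module, i.e. the module of all sequences $x=(x_i)_{i\in\mathbb N}$ in $\mathcal A$ for which $\sum_i x_i^*x_i$ converges in norm, with inner product $\langle x,y\rangle=\sum_i x_i^*y_i$ and norm $\|x\|=\|\langle x,x\rangle\|^{1/2}$. Let $B^a(H_{\mathcal A})$ be the algebra of bounded adjointable operators on $H_{\mathcal A}$, and let $K(H_{\mathcal A})$ be its ideal of compact operators, i.e. the closure in the operator norm of the linear span of the operators $\theta_{x,y}:z\mapsto x\langle y,z\rangle$ with $x,y\in H_{\mathcal A}$. An operator $D\in B^a(H_{\mathcal A})$ is called lower semi-$\mathcal A$-Fredholm if there are closed submodules $M_1,N_1,M_2,N_2$ of $H_{\mathcal A}$ such that - $H_{\mathcal A}=M_1\,\tilde\oplus\, N_1=M_2\,\tilde\oplus\, N_2$ (direct sums of submodules, not necessarily orthogonal); - $D(M_1)\subseteq M_2$, $D(N_1)\subseteq N_2$, and $D|_{M_1}:M_1\to M_2$ is an isomorphism ($\mathcal A$-linear, bounded, with bounded inverse); - $N_2$ is finitely generated,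 i.e. it is the linear span over $\mathcal A$ of a finite set. **Theorem.** Let $D\in B^a(H_{\mathcal A})$. The following statements are equivalent: 1. $D$ is lower semi-$\mathcal A$-Fredholm. 2. There exist $F\in B^a(H_{\mathcal A})$ and $K\in K(H_{\mathcal A})$ such that $DF=I+K$. 3. The class of $D$ is right invertible in the Calkin algebra $B^a(H_{\mathcal A})/K(H_{\mathcal A})$. -/

import Mathlib

open scoped MulOpposite

/-! # The standard Hilbert module over a unital C⋆-algebra and its semi-Fredholm operators

`A` is a unital C⋆-algebra.  Right `A`-modules are modules over `Aᵐᵒᵖ`: the element `x a` is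
written `MulOpposite.op a • x`. -/

namespace HilbertMod

section Summability

theorem summable_of_nonneg_of_le {A : Type*} [CStarAlgebra A] [PartialOrder A] [StarOrderedRing A]
    {f g : ℕ → A} (hf : ∀ i, 0 ≤ f i) (hfg : ∀ i, f i ≤ g i) (hg : Summable g) : Summable f := by
  rw [summable_iff_vanishing_norm] at hg ⊢
  intro ε hε
  obtain ⟨s, hs⟩ := hg ε hε
  refine ⟨s, fun t ht => lt_of_le_of_lt ?_ (hs t ht)⟩
  exact CStarAlgebra.norm_le_norm_of_nonneg_of_le (Finset.sum_nonneg fun i _ => hf i)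
    (Finset.sum_le_sum fun i _ => hfg i)

theorem summable_add {A : Type*} [CStarAlgebra A] {x y : ℕ → A}
    (hx : Summable fun i => star (x i) * x i) (hy : Summable fun i => star (y i) * y i) :
    Summable fun i => star (x i + y i) * (x i + y i) := by
  let _ := CStarAlgebra.spectralOrder A
  have _ := CStarAlgebra.spectralOrderedRing A
  refine summable_of_nonneg_of_le (fun i => star_mul_self_nonneg _) (fun i => ?_)
    ((hx.add hy).add (hx.add hy))
  rw [← sub_nonneg]
  have h := star_mul_self_nonneg (x i - y i)
  convert h using 1
  simp only [star_add, star_sub, add_mul, mul_add, sub_mul, mul_sub]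
  abel

theorem summable_mul_right {A : Type*} [CStarAlgebra A] {x : ℕ → A} (a : A)
    (hx : Summable fun i => star (x i) * x i) :
    Summable fun i => star (x i * a) * (x i * a) := by
  have h := (hx.mul_left (star a)).mul_right a
  simpa only [star_mul, mul_assoc] using h

theorem summable_star_mul {A : Type*} [CStarAlgebra A] {x y : ℕ → A}
    (hx : Summable fun i => star (x i) * x i) (hy : Summable fun i => star (y i) * y i) :
    Summable fun i => star (x i) * y i := by
  have h1 := ((summable_add hx hy).sub hx).sub hy
  have hy' : Summable fun i => star (Complex.I • y i) * (Complex.I • y i) := by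
    simpa [smul_smul] using hy
  have h2 := ((summable_add hx hy').sub hx).sub hy'
  have h3 := (h1.sub (h2.const_smul Complex.I)).const_smul (1 / 2 : ℂ)
  refine h3.congr fun i => ?_
  simp only [star_add, star_smul, add_mul, mul_add, smul_mul_assoc, mul_smul_comm, smul_add,
    smul_sub, smul_smul, RCLike.star_def, Complex.conj_I]
  match_scalars <;> ring_nf <;> norm_num [Complex.I_sq]

end Summability

/-- The sequences `x` in `A` for which `∑ (x i)⋆ (x i)` converges in norm (for a series of positive
elements, unconditional convergence and convergence of the partial sums are the same), as a right
`A`-submodule of the module of all sequences. -/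
def squareSummable (A : Type*) [CStarAlgebra A] : Submodule Aᵐᵒᵖ (ℕ → A) where
  carrier := {x | Summable fun i => star (x i) * x i}
  add_mem' := fun hx hy => summable_add hx hy
  zero_mem' := by simp
  smul_mem' := fun a _ hx => summable_mul_right a.unop hx

/-- The standard Hilbert module `H_A` over `A`. This is a type synonym, so that it does not inherit
the product topology. -/
def StdModule (A : Type*) [CStarAlgebra A] : Type _ := squareSummable A

namespace StdModule

noncomputable instance (A : Type*) [CStarAlgebra A] : AddCommGroup (StdModule A) :=
  inferInstanceAs (AddCommGroup (squareSummable A))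

noncomputable instance (A : Type*) [CStarAlgebra A] : Module Aᵐᵒᵖ (StdModule A) :=
  inferInstanceAs (Module Aᵐᵒᵖ (squareSummable A))

noncomputable instance (A : Type*) [CStarAlgebra A] : Module ℂ (StdModule A) :=
  inferInstanceAs (Module ℂ (squareSummable A))

instance (A : Type*) [CStarAlgebra A] : IsScalarTower ℂ Aᵐᵒᵖ (StdModule A) :=
  inferInstanceAs (IsScalarTower ℂ Aᵐᵒᵖ (squareSummable A))

/-- The `i`-th entry of `x`. -/
def coord {A : Type*} [CStarAlgebra A] (x : StdModule A) (i : ℕ) : A := x.1 i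

theorem ext_coord {A : Type*} [CStarAlgebra A] {x y : StdModule A}
    (h : ∀ i, x.coord i = y.coord i) : x = y := Subtype.ext (funext h)

theorem summable_coord {A : Type*} [CStarAlgebra A] (x y : StdModule A) :
    Summable fun i => star (x.coord i) * y.coord i := summable_star_mul x.2 y.2

@[simp] theorem coord_add {A : Type*} [CStarAlgebra A] (x y : StdModule A) (i : ℕ) :
    (x + y).coord i = x.coord i + y.coord i := rfl

@[simp] theorem coord_zero {A : Type*} [CStarAlgebra A] (i : ℕ) :
    (0 : StdModule A).coord i = 0 := rfl

@[simp] theorem coord_op_smul {A : Type*} [CStarAlgebra A] (a : Aᵐᵒᵖ) (x : StdModule A) (i : ℕ) :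
    (a • x).coord i = x.coord i * a.unop := rfl

@[simp] theorem coord_smul {A : Type*} [CStarAlgebra A] (c : ℂ) (x : StdModule A) (i : ℕ) :
    (c • x).coord i = c • x.coord i := rfl

/-- The `A`-valued inner product `⟨x, y⟩ = ∑ (x i)⋆ (y i)`. -/
noncomputable def ip {A : Type*} [CStarAlgebra A] (x y : StdModule A) : A :=
  ∑' i, star (x.coord i) * y.coord i

theorem ip_add_right {A : Type*} [CStarAlgebra A] (x y z : StdModule A) :
    ip x (y + z) = ip x y + ip x z := by
  simp only [ip, coord_add, mul_add]
  exact (summable_coord x y).tsum_add (summable_coord x z)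

theorem ip_op_smul_right {A : Type*} [CStarAlgebra A] (x y : StdModule A) (a : Aᵐᵒᵖ) :
    ip x (a • y) = ip x y * a.unop := by
  simp only [ip, coord_op_smul, ← mul_assoc]
  exact (summable_coord x y).tsum_mul_right a.unop

theorem ip_smul_right {A : Type*} [CStarAlgebra A] (x y : StdModule A) (c : ℂ) :
    ip x (c • y) = c • ip x y := by
  simp only [ip, coord_smul, mul_smul_comm]
  exact (summable_coord x y).tsum_const_smul c

theorem star_ip {A : Type*} [CStarAlgebra A] (x y : StdModule A) : star (ip x y) = ip y x := by
  simp [ip, tsum_star]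

theorem ip_self_eq_zero {A : Type*} [CStarAlgebra A] {x : StdModule A} :
    ip x x = 0 ↔ x = 0 := by
  let _ := CStarAlgebra.spectralOrder A
  have _ := CStarAlgebra.spectralOrderedRing A
  refine ⟨fun h => ext_coord fun i => ?_, fun h => by simp [ip, h]⟩
  have h0 : ∀ j, 0 ≤ star (x.coord j) * x.coord j := fun j => star_mul_self_nonneg _
  have h1 := (summable_coord x x).le_tsum i (fun j _ => h0 j)
  have h2 : star (x.coord i) * x.coord i = 0 := le_antisymm (h1.trans h.le) (h0 i)
  simpa using h2

/-- The norm `‖x‖ = ‖⟨x, x⟩‖ ^ (1 / 2)`. -/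
noncomputable instance (A : Type*) [CStarAlgebra A] : Norm (StdModule A) where
  norm x := √‖ip x x‖

/-- `H_A` is a Hilbert C⋆-module in the sense of Mathlib, over `Aᵐᵒᵖ` since it is a right module. -/
noncomputable instance (A : Type*) [CStarAlgebra A] [PartialOrder A] [StarOrderedRing A] :
    CStarModule Aᵐᵒᵖ (StdModule A) where
  inner x y := MulOpposite.op (ip x y)
  inner_add_right := by intro x y z; simp [ip_add_right]
  inner_self_nonneg := by
    intro x
    exact (tsum_nonneg fun i => star_mul_self_nonneg (x.coord i) : 0 ≤ ip x x)
  inner_self := by intro x; simp [ip_self_eq_zero]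
  inner_op_smul_right := by
    intro a x y; apply MulOpposite.unop_injective; simp [ip_op_smul_right]
  inner_smul_right_complex := by intro c x y; simp [ip_smul_right]
  star_inner := by intro x y; apply MulOpposite.unop_injective; simp [star_ip]
  norm_eq_sqrt_norm_inner_self := fun x => rfl

theorem normedSpaceCore (A : Type*) [CStarAlgebra A] : NormedSpace.Core ℂ (StdModule A) := by
  let _ := CStarAlgebra.spectralOrder A
  have _ := CStarAlgebra.spectralOrderedRing A
  exact CStarModule.normedSpaceCore Aᵐᵒᵖ

noncomputable instance (A : Type*) [CStarAlgebra A] : NormedAddCommGroup (StdModule A) :=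
  NormedAddCommGroup.ofCore (normedSpaceCore A)

noncomputable instance (A : Type*) [CStarAlgebra A] : NormedSpace ℂ (StdModule A) :=
  NormedSpace.ofCore (normedSpaceCore A)

theorem norm_sq_eq {A : Type*} [CStarAlgebra A] (x : StdModule A) : ‖x‖ ^ 2 = ‖ip x x‖ :=
  Real.sq_sqrt (norm_nonneg _)

theorem norm_ip_le {A : Type*} [CStarAlgebra A] (x y : StdModule A) :
    ‖ip x y‖ ≤ ‖x‖ * ‖y‖ := by
  let _ := CStarAlgebra.spectralOrder A
  have _ := CStarAlgebra.spectralOrderedRing A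
  exact CStarModule.norm_inner_le (A := Aᵐᵒᵖ) (StdModule A) (x := x) (y := y)

theorem ip_op_smul_left {A : Type*} [CStarAlgebra A] (x y : StdModule A) (a : Aᵐᵒᵖ) :
    ip (a • x) y = star a.unop * ip x y := by
  rw [← star_ip, ip_op_smul_right, star_mul, star_ip]

theorem norm_op_smul_le {A : Type*} [CStarAlgebra A] (x : StdModule A) (a : Aᵐᵒᵖ) :
    ‖a • x‖ ≤ ‖x‖ * ‖a.unop‖ := by
  refine le_of_sq_le_sq ?_ (by positivity)
  rw [norm_sq_eq, ip_op_smul_left, ip_op_smul_right, mul_pow, norm_sq_eq]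
  calc _ ≤ ‖star a.unop‖ * (‖ip x x‖ * ‖a.unop‖) :=
        (norm_mul_le _ _).trans (by gcongr; exact norm_mul_le _ _)
    _ = _ := by rw [norm_star]; ring

theorem eq_of_ip_left {A : Type*} [CStarAlgebra A] {y z : StdModule A}
    (h : ∀ x, ip x y = ip x z) : y = z := by
  have h1 : ip (y - z) ((-1 : ℂ) • z + y) = 0 := by
    rw [ip_add_right, ip_smul_right, h (y - z)]; simp
  have h2 : (-1 : ℂ) • z + y = y - z := by module
  rw [h2, ip_self_eq_zero, sub_eq_zero] at h1
  exact h1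

end StdModule

open StdModule

/-- The algebra `Bᵃ(H_A)` of bounded adjointable operators on `H_A`. Adjointable operators are
automatically `A`-linear, see `Adjointable.map_op_smul`. -/
noncomputable def Adjointable (A : Type*) [CStarAlgebra A] :
    Subalgebra ℂ (StdModule A →L[ℂ] StdModule A) where
  carrier := {T | ∃ S : StdModule A →L[ℂ] StdModule A, ∀ x y, ip (T x) y = ip x (S y)}
  mul_mem' := by
    rintro T T' ⟨S, hS⟩ ⟨S', hS'⟩
    exact ⟨S' * S, fun x y => by simp [hS, hS']⟩
  add_mem' := by
    rintro T T' ⟨S, hS⟩ ⟨S', hS'⟩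
    refine ⟨S + S', fun x y => ?_⟩
    rw [← star_ip]
    simp only [add_apply, ip_add_right, star_add, star_ip, hS, hS']
  algebraMap_mem' := by
    intro c
    refine ⟨algebraMap ℂ _ (star c), fun x y => ?_⟩
    rw [← star_ip]
    simp only [Algebra.algebraMap_eq_smul_one, smul_apply,
      one_apply_eq_self, ip_smul_right, star_smul, star_ip]

namespace Adjointable

theorem map_op_smul {A : Type*} [CStarAlgebra A] (T : Adjointable A) (a : Aᵐᵒᵖ)
    (x : StdModule A) : T.1 (a • x) = a • T.1 x := by
  obtain ⟨S, hS⟩ := T.2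
  have hS' : ∀ x y, ip x (T.1 y) = ip (S x) y := fun x y => by
    rw [← star_ip, hS, star_ip]
  exact eq_of_ip_left fun y => by rw [hS', ip_op_smul_right, ip_op_smul_right, hS']

/-- The elementary operator `θ_{x,y} : z ↦ x ⟨y, z⟩`, with adjoint `θ_{y,x}`. -/
noncomputable def rankOneCLM {A : Type*} [CStarAlgebra A] (x y : StdModule A) :
    StdModule A →L[ℂ] StdModule A :=
  LinearMap.mkContinuous
    { toFun := fun z => MulOpposite.op (ip y z) • x
      map_add' := fun z w => by rw [ip_add_right, MulOpposite.op_add, add_smul]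
      map_smul' := fun c z => by
        rw [ip_smul_right, MulOpposite.op_smul, smul_assoc, RingHom.id_apply] }
    (‖x‖ * ‖y‖) (fun z => by
      refine (norm_op_smul_le _ _).trans ?_
      rw [mul_assoc]
      gcongr
      exact norm_ip_le y z)

theorem rankOneCLM_apply {A : Type*} [CStarAlgebra A] (x y z : StdModule A) :
    rankOneCLM x y z = MulOpposite.op (ip y z) • x := rfl

/-- `θ_{x,y}` as an adjointable operator. -/
noncomputable def rankOne {A : Type*} [CStarAlgebra A] (x y : StdModule A) : Adjointable A :=
  ⟨rankOneCLM x y, rankOneCLM y x, fun z w => by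
    rw [rankOneCLM_apply, rankOneCLM_apply, ip_op_smul_left, ip_op_smul_right]
    simp [star_ip]⟩

/-- The compact operators `K(H_A)`: the closure, in the operator norm, of the linear span of the
elementary operators `θ_{x,y}`. -/
noncomputable def compacts (A : Type*) [CStarAlgebra A] : Submodule ℂ (Adjointable A) :=
  (Submodule.span ℂ {T | ∃ x y : StdModule A, T = rankOne x y}).topologicalClosure

theorem mul_rankOne {A : Type*} [CStarAlgebra A] (T : Adjointable A) (x y : StdModule A) :
    T * rankOne x y = rankOne (T.1 x) y := by
  ext1
  ext1 z
  exact map_op_smul T _ x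

theorem rankOne_mul {A : Type*} [CStarAlgebra A] (T : Adjointable A) (x y : StdModule A) :
    ∃ w, rankOne x y * T = rankOne x w := by
  obtain ⟨S, hS⟩ := T.2
  refine ⟨S y, ?_⟩
  ext1
  ext1 z
  change MulOpposite.op (ip y (T.1 z)) • x = MulOpposite.op (ip (S y) z) • x
  rw [← star_ip, hS, star_ip]

theorem mul_mem_compacts_left {A : Type*} [CStarAlgebra A] (T : Adjointable A)
    {K : Adjointable A} (hK : K ∈ compacts A) : T * K ∈ compacts A := by
  refine map_mem_closure (f := fun K => T * K) (by fun_prop) hK fun L hL => ?_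
  induction hL using Submodule.span_induction with
  | mem L h =>
    obtain ⟨x, y, rfl⟩ := h
    exact Submodule.subset_span ⟨_, _, mul_rankOne T x y⟩
  | zero => simp
  | add L M _ _ h1 h2 =>
    change T * (L + M) ∈ Submodule.span ℂ _
    rw [mul_add]
    exact Submodule.add_mem _ h1 h2
  | smul c L _ h =>
    change T * (c • L) ∈ Submodule.span ℂ _
    rw [mul_smul_comm]
    exact Submodule.smul_mem _ c h

theorem mul_mem_compacts_right {A : Type*} [CStarAlgebra A] (T : Adjointable A)
    {K : Adjointable A} (hK : K ∈ compacts A) : K * T ∈ compacts A := by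
  refine map_mem_closure (f := fun K => K * T) (by fun_prop) hK fun L hL => ?_
  induction hL using Submodule.span_induction with
  | mem L h =>
    obtain ⟨x, y, rfl⟩ := h
    obtain ⟨w, hw⟩ := rankOne_mul T x y
    exact Submodule.subset_span ⟨_, _, hw⟩
  | zero => simp
  | add L M _ _ h1 h2 =>
    change (L + M) * T ∈ Submodule.span ℂ _
    rw [add_mul]
    exact Submodule.add_mem _ h1 h2
  | smul c L _ h =>
    change (c • L) * T ∈ Submodule.span ℂ _
    rw [smul_mul_assoc]
    exact Submodule.smul_mem _ c h

/-- `K(H_A)` as a two-sided ideal of `Bᵃ(H_A)`. -/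
noncomputable def compactIdeal (A : Type*) [CStarAlgebra A] : Ideal (Adjointable A) where
  carrier := compacts A
  add_mem' := fun h1 h2 => (compacts A).add_mem h1 h2
  zero_mem' := (compacts A).zero_mem
  smul_mem' := fun T _ h => mul_mem_compacts_left T h

instance (A : Type*) [CStarAlgebra A] : (compactIdeal A).IsTwoSided where
  mul_mem_of_left := fun T h => mul_mem_compacts_right T h

/-- The Calkin algebra `Bᵃ(H_A) / K(H_A)`. -/
def Calkin (A : Type*) [CStarAlgebra A] : Type _ := Adjointable A ⧸ compactIdeal A

noncomputable instance (A : Type*) [CStarAlgebra A] : Ring (Calkin A) :=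
  inferInstanceAs (Ring (Adjointable A ⧸ compactIdeal A))

/-- The quotient map `Bᵃ(H_A) → Bᵃ(H_A) / K(H_A)`. -/
noncomputable def toCalkin (A : Type*) [CStarAlgebra A] : Adjointable A →+* Calkin A :=
  Ideal.Quotient.mk (compactIdeal A)

/-- `D` is lower semi-`A`-Fredholm: there are decompositions `H_A = M₁ ⊕ N₁ = M₂ ⊕ N₂` into closed
(not necessarily orthogonal) submodules such that `D` restricts to an isomorphism `M₁ → M₂`
(`A`-linear, bounded, with bounded inverse), maps `N₁` into `N₂`, and `N₂` is the `A`-linear span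
of a finite set. -/
def IsLowerSemiFredholm {A : Type*} [CStarAlgebra A] (D : Adjointable A) : Prop :=
  ∃ M₁ N₁ M₂ N₂ : Submodule Aᵐᵒᵖ (StdModule A),
    IsClosed (M₁ : Set (StdModule A)) ∧ IsClosed (N₁ : Set (StdModule A)) ∧
    IsClosed (M₂ : Set (StdModule A)) ∧ IsClosed (N₂ : Set (StdModule A)) ∧
    IsCompl M₁ N₁ ∧ IsCompl M₂ N₂ ∧
    (∃ e : M₁ ≃L[Aᵐᵒᵖ] M₂, ∀ x : M₁, (e x : StdModule A) = D.1 x) ∧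
    (∀ x ∈ N₁, D.1 x ∈ N₂) ∧
    N₂.FG

end Adjointable

end HilbertMod

open scoped MulOpposite
open Filter Topology

namespace HilbertMod

namespace StdModule

/-! ### Norm estimates and completeness of `StdModule A`. -/

variable {A : Type*} [CStarAlgebra A]

/-! Fredholm to right inverse: the range of `D` and finitely many generators `g j` of `N₂` together
span `H_A`, so the map `T : (x, a) ↦ D x + ∑ g j a j` is onto. By the open mapping theorem `T T* = D
D* + ∑ θ_{g j, g j}` is bounded below; being symmetric, it is invertible
(`isUnit_of_symmetric_of_bounded_below`). With `S = T T*` and `G = ∑ θ_{g j, g j}`, this reads `D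
(D* S⁻¹) = 1 - G S⁻¹`, and `G S⁻¹` is compact.

Right inverse to Fredholm: let `P` project onto a tail of the sequences. If `D F = 1 + K` with `K`
compact, then `‖P K‖ < 1` for a far enough tail (`exists_norm_tail_mul_lt_one`), so `1 + P K` has an
inverse `W`, and `R = F W P` satisfies `R P = R` and `P D R = P`. Hence `R D` and `D R` are
idempotents, whose ranges and kernels give the two decompositions (`isLowerSemiFredholm_of_tail`);
the kernel of `D R` is `ker P`, generated by finitely many basis sequences.

The Calkin statement is the second one read modulo the ideal of compacts. -/

theorem norm_sum_star_mul_le (x : StdModule A) (s : Finset ℕ) :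
    ‖∑ i ∈ s, star (x.coord i) * x.coord i‖ ≤ ‖x‖ ^ 2 := by
  let _ := CStarAlgebra.spectralOrder A
  have _ := CStarAlgebra.spectralOrderedRing A
  rw [norm_sq_eq]
  exact CStarAlgebra.norm_le_norm_of_nonneg_of_le
    (Finset.sum_nonneg fun i _ => star_mul_self_nonneg _)
    ((summable_coord x x).sum_le_tsum s fun i _ => star_mul_self_nonneg _)

theorem norm_coord_le (x : StdModule A) (i : ℕ) : ‖x.coord i‖ ≤ ‖x‖ := by
  have h := norm_sum_star_mul_le x {i}
  rw [Finset.sum_singleton, CStarRing.norm_star_mul_self, ← sq] at h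
  exact le_of_sq_le_sq h (norm_nonneg _)

theorem norm_sq_le_of_forall_sum_le {x : StdModule A} {c : ℝ}
    (h : ∀ s : Finset ℕ, ‖∑ i ∈ s, star (x.coord i) * x.coord i‖ ≤ c) : ‖x‖ ^ 2 ≤ c := by
  rw [norm_sq_eq]
  exact le_of_tendsto (summable_coord x x).hasSum.norm (Eventually.of_forall h)

@[simp] theorem coord_sub (x y : StdModule A) (i : ℕ) :
    (x - y).coord i = x.coord i - y.coord i := rfl

/-- The `i`-th entry as an additive homomorphism. -/
def coordHom (A : Type*) [CStarAlgebra A] (i : ℕ) : StdModule A →+ A where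
  toFun x := x.coord i
  map_zero' := rfl
  map_add' _ _ := rfl

theorem coord_sum {ι : Type*} (s : Finset ι) (f : ι → StdModule A) (i : ℕ) :
    (∑ j ∈ s, f j).coord i = ∑ j ∈ s, (f j).coord i :=
  map_sum (coordHom A i) f s

/-- If the coordinatewise distance to a square summable sequence is bounded on all finite sets by
`ε`, for every `ε > 0`, then the sequence is square summable. -/
theorem summable_of_forall_exists_approx {x : ℕ → A}
    (h : ∀ ε > 0, ∃ y : StdModule A, ∀ s : Finset ℕ,
      ‖∑ i ∈ s, star (x i - y.coord i) * (x i - y.coord i)‖ ≤ ε) :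
    Summable fun i => star (x i) * x i := by
  let _ := CStarAlgebra.spectralOrder A
  have _ := CStarAlgebra.spectralOrderedRing A
  rw [summable_iff_vanishing_norm]
  intro ε hε
  obtain ⟨y, hy⟩ := h (ε / 8) (by positivity)
  obtain ⟨s, hs⟩ := summable_iff_vanishing_norm.1 (summable_coord y y) (ε / 8) (by positivity)
  refine ⟨s, fun t ht => ?_⟩
  -- This is `|u + v|² ≤ 2|u|² + 2|v|²` with `u = x - y`, `v = y`; the difference of the sides is
  -- `|u - v|²`. The factor 2 on two terms of size `ε / 8` leaves at most `ε / 2`.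
  have key : ∑ i ∈ t, star (x i) * x i ≤
      (∑ i ∈ t, star (x i - y.coord i) * (x i - y.coord i) +
        ∑ i ∈ t, star (y.coord i) * y.coord i) +
      (∑ i ∈ t, star (x i - y.coord i) * (x i - y.coord i) +
        ∑ i ∈ t, star (y.coord i) * y.coord i) := by
    simp only [← Finset.sum_add_distrib]
    refine Finset.sum_le_sum fun i _ => ?_
    rw [← sub_nonneg]
    convert star_mul_self_nonneg (x i - y.coord i - y.coord i) using 1
    simp only [star_sub, mul_sub, sub_mul]
    abel
  have h1 := CStarAlgebra.norm_le_norm_of_nonneg_of_le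
    (Finset.sum_nonneg fun i _ => star_mul_self_nonneg _) key
  have h2 := norm_add_le (∑ i ∈ t, star (x i - y.coord i) * (x i - y.coord i))
    (∑ i ∈ t, star (y.coord i) * y.coord i)
  have h3 := h1.trans (norm_add_le _ _)
  have h4 := hy t
  have h5 := hs t ht
  linarith

/-- Completeness is what the open mapping theorem and the Neumann series arguments below rest on. -/
instance : CompleteSpace (StdModule A) := by
  refine Metric.complete_of_cauchySeq_tendsto fun u hu => ?_
  have hc : ∀ i, CauchySeq fun n => (u n).coord i := fun i => by
    refine Metric.cauchySeq_iff.2 fun ε hε => ?_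
    obtain ⟨N, hN⟩ := Metric.cauchySeq_iff.1 hu ε hε
    refine ⟨N, fun m hm n hn => lt_of_le_of_lt ?_ (hN m hm n hn)⟩
    rw [dist_eq_norm, dist_eq_norm, ← coord_sub]
    exact norm_coord_le _ i
  choose x hx using fun i => cauchySeq_tendsto_of_complete (hc i)
  -- Uniformity in the finite set `s` lets this one bound give both square summability of the
  -- coordinatewise limit and convergence in norm.
  have key : ∀ δ > 0, ∃ N, ∀ n ≥ N, ∀ s : Finset ℕ,
      ‖∑ i ∈ s, star (x i - (u n).coord i) * (x i - (u n).coord i)‖ ≤ δ ^ 2 := by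
    intro δ hδ
    obtain ⟨N, hN⟩ := Metric.cauchySeq_iff.1 hu δ hδ
    refine ⟨N, fun n hn s => ?_⟩
    have hlim : Tendsto (fun m => ‖∑ i ∈ s, star ((u m).coord i - (u n).coord i) *
        ((u m).coord i - (u n).coord i)‖) atTop
        (𝓝 ‖∑ i ∈ s, star (x i - (u n).coord i) * (x i - (u n).coord i)‖) :=
      (tendsto_finsetSum s fun i _ =>
        ((hx i).sub_const _).star.mul ((hx i).sub_const _)).norm
    refine le_of_tendsto hlim ((eventually_ge_atTop N).mono fun m hm => ?_)
    refine (norm_sum_star_mul_le (u m - u n) s).trans ?_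
    have := (hN m hm n hn).le
    rw [dist_eq_norm] at this
    gcongr
  have hsum : Summable fun i => star (x i) * x i := by
    refine summable_of_forall_exists_approx fun ε hε => ?_
    obtain ⟨N, hN⟩ := key (√ε) (Real.sqrt_pos.2 hε)
    exact ⟨u N, fun s => (hN N le_rfl s).trans (Real.sq_sqrt hε.le).le⟩
  let z : StdModule A := ⟨x, hsum⟩
  refine ⟨z, Metric.tendsto_atTop.2 fun ε hε => ?_⟩
  obtain ⟨N, hN⟩ := key (ε / 2) (by positivity)
  refine ⟨N, fun n hn => ?_⟩
  have h1 : ‖z - u n‖ ^ 2 ≤ (ε / 2) ^ 2 := norm_sq_le_of_forall_sum_le fun s => hN n hn s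
  have h2 := le_of_sq_le_sq h1 (by positivity)
  rw [dist_comm, dist_eq_norm]
  linarith

instance : IsBoundedSMul Aᵐᵒᵖ (StdModule A) :=
  .of_norm_smul_le fun a x => by
    rw [mul_comm]
    exact norm_op_smul_le x a

/-! ### Tails of sequences -/

theorem sum_star_mul_tail (x : StdModule A) (n : ℕ) (s : Finset ℕ) :
    ∑ i ∈ s, star (if i < n then 0 else x.coord i) * (if i < n then 0 else x.coord i) =
      ∑ i ∈ s with ¬ i < n, star (x.coord i) * x.coord i := by
  rw [Finset.sum_filter]
  refine Finset.sum_congr rfl fun i _ => ?_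
  split_ifs <;> simp

/-- The sequence `x` with its first `n` entries replaced by `0`. -/
def tail (n : ℕ) (x : StdModule A) : StdModule A :=
  ⟨fun i => if i < n then 0 else x.coord i, by
    let _ := CStarAlgebra.spectralOrder A
    have _ := CStarAlgebra.spectralOrderedRing A
    refine summable_of_nonneg_of_le (fun i => star_mul_self_nonneg _) (fun i => ?_)
      (summable_coord x x)
    dsimp only
    split_ifs
    · simp
    · exact le_rfl⟩

theorem coord_tail (n : ℕ) (x : StdModule A) (i : ℕ) :
    (tail n x).coord i = if i < n then 0 else x.coord i := rfl

theorem norm_tail_le (n : ℕ) (x : StdModule A) : ‖tail n x‖ ≤ ‖x‖ := by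
  refine le_of_sq_le_sq (norm_sq_le_of_forall_sum_le fun s => ?_) (norm_nonneg _)
  simp only [coord_tail, sum_star_mul_tail]
  exact norm_sum_star_mul_le x _

theorem tendsto_tail (x : StdModule A) : Tendsto (fun n => tail n x) atTop (𝓝 0) := by
  refine Metric.tendsto_atTop.2 fun ε hε => ?_
  obtain ⟨s, hs⟩ := summable_iff_vanishing_norm.1 (summable_coord x x) ((ε / 2) ^ 2)
    (by positivity)
  obtain ⟨N, hN⟩ := s.exists_nat_subset_range
  refine ⟨N, fun n hn => ?_⟩
  have h1 : ‖tail n x‖ ^ 2 ≤ (ε / 2) ^ 2 := norm_sq_le_of_forall_sum_le fun t => by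
    simp only [coord_tail, sum_star_mul_tail]
    refine (hs _ (Finset.disjoint_left.2 fun i hi his => ?_)).le
    have := Finset.mem_range.1 (hN his)
    have := (Finset.mem_filter.1 hi).2
    omega
  have h2 := le_of_sq_le_sq h1 (by positivity)
  rw [dist_zero_right]
  linarith

/-- The projection to the `n`-th tail as a bounded operator. -/
noncomputable def tailCLM (A : Type*) [CStarAlgebra A] (n : ℕ) : StdModule A →L[ℂ] StdModule A :=
  LinearMap.mkContinuous
    { toFun := tail n
      map_add' := fun x y => ext_coord fun i => by
        simp only [coord_tail, coord_add]; split_ifs <;> simp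
      map_smul' := fun c x => ext_coord fun i => by
        simp only [coord_tail, coord_smul, RingHom.id_apply]; split_ifs <;> simp }
    1 fun x => by simpa using norm_tail_le n x

theorem tailCLM_apply (n : ℕ) (x : StdModule A) : tailCLM A n x = tail n x := rfl

theorem norm_tailCLM_le (n : ℕ) : ‖tailCLM A n‖ ≤ 1 :=
  LinearMap.mkContinuous_norm_le _ zero_le_one _

theorem tailCLM_op_smul (n : ℕ) (a : Aᵐᵒᵖ) (x : StdModule A) :
    tailCLM A n (a • x) = a • tailCLM A n x := ext_coord fun i => by
  simp only [tailCLM_apply, coord_tail, coord_op_smul]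
  split_ifs <;> simp

theorem tailCLM_idem (n : ℕ) (x : StdModule A) :
    tailCLM A n (tailCLM A n x) = tailCLM A n x := ext_coord fun i => by
  simp only [tailCLM_apply, coord_tail]
  split_ifs <;> rfl

/-- The `i`-th standard basis sequence. -/
def single (A : Type*) [CStarAlgebra A] (i : ℕ) : StdModule A :=
  ⟨Pi.single i 1, summable_of_ne_finset_zero (s := {i}) fun j hj => by
    simp [Pi.single_eq_of_ne (Finset.notMem_singleton.1 hj)]⟩

theorem coord_single (i j : ℕ) : (single A i).coord j = if j = i then 1 else 0 :=
  Pi.single_apply i 1 j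

/-- Source of the finite generation of `N₂`, which will be the kernel of a tail projection. -/
theorem eq_sum_of_tail_eq_zero {n : ℕ} {x : StdModule A} (h : tail n x = 0) :
    x = ∑ i ∈ Finset.range n, MulOpposite.op (x.coord i) • single A i := by
  refine ext_coord fun j => ?_
  have hj : (tail n x).coord j = 0 := by rw [h, coord_zero]
  rw [coord_tail] at hj
  simp only [coord_sum, coord_op_smul, coord_single, MulOpposite.unop_op, ite_mul, one_mul,
    zero_mul, Finset.sum_ite_eq, Finset.mem_range]
  split_ifs at hj ⊢
  · rfl
  · exact hj

theorem tail_single {n i : ℕ} (h : i < n) : tail n (single A i) = 0 := ext_coord fun j => by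
  rw [coord_tail, coord_single, coord_zero]
  split_ifs <;> first | rfl | omega

/-! ### Symmetric operators -/

theorem ip_smul_left (x y : StdModule A) (c : ℂ) : ip (c • x) y = star c • ip x y := by
  rw [← star_ip, ip_smul_right, star_smul, star_ip]

theorem ip_add_left (x y z : StdModule A) : ip (x + y) z = ip x z + ip y z := by
  rw [← star_ip, ip_add_right, star_add, star_ip, star_ip]

theorem ip_sum_right {ι : Type*} (s : Finset ι) (x : StdModule A) (f : ι → StdModule A) :
    ip x (∑ j ∈ s, f j) = ∑ j ∈ s, ip x (f j) :=
  map_sum (⟨⟨ip x, by simpa using ip_smul_right x 0 0⟩, ip_add_right x⟩ : StdModule A →+ A) f s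

theorem ip_self_nonneg [PartialOrder A] [StarOrderedRing A] (x : StdModule A) : 0 ≤ ip x x :=
  tsum_nonneg fun i => star_mul_self_nonneg (x.coord i)

theorem norm_le_of_ip_self_le {x : StdModule A} [PartialOrder A] [StarOrderedRing A] {a : A}
    (h : ip x x ≤ a) : ‖x‖ ^ 2 ≤ ‖a‖ := by
  rw [norm_sq_eq]
  exact CStarAlgebra.norm_le_norm_of_nonneg_of_le (ip_self_nonneg x) h

/-- For a symmetric operator `S` and real `t`, `‖S x‖ ≤ ‖S x + i t x‖`. -/
theorem norm_le_norm_add_I_smul {S : StdModule A →L[ℂ] StdModule A}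
    (hS : ∀ x y, ip (S x) y = ip x (S y)) (t : ℝ) (x : StdModule A) :
    ‖S x‖ ≤ ‖S x + ((t : ℂ) * Complex.I) • x‖ := by
  let _ := CStarAlgebra.spectralOrder A
  have _ := CStarAlgebra.spectralOrderedRing A
  -- The cross terms cancel: `S` is symmetric and `i t` is skew.
  have h : ip (S x + ((t : ℂ) * Complex.I) • x) (S x + ((t : ℂ) * Complex.I) • x) =
      ip (S x) (S x) + ip ((t : ℂ) • x) ((t : ℂ) • x) := by
    simp only [ip_add_left, ip_add_right, ip_smul_left, ip_smul_right, hS, smul_smul]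
    match_scalars <;> simp
    linear_combination (-(t : ℂ) ^ 2) * Complex.I_sq
  refine le_of_sq_le_sq ?_ (norm_nonneg _)
  rw [norm_sq_eq (S x + _), h, norm_sq_eq]
  exact CStarAlgebra.norm_le_norm_of_nonneg_of_le (ip_self_nonneg _)
    (le_add_of_nonneg_right (ip_self_nonneg _))

/-- A symmetric operator which is bounded below is invertible. -/
theorem isUnit_of_symmetric_of_bounded_below {S : StdModule A →L[ℂ] StdModule A}
    (hS : ∀ x y, ip (S x) y = ip x (S y)) {c : ℝ} (hc : 0 < c)
    (h : ∀ x, ‖x‖ ≤ c * ‖S x‖) : IsUnit S := by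
  -- Continuity method along `S + i t`: it is invertible for large `t`, and its inverse, where it
  -- exists, has norm at most `c`. Invertibility therefore propagates over steps of a fixed length
  -- down to `t = 0`.
  let B : ℝ → (StdModule A →L[ℂ] StdModule A) := fun t => S + ((t : ℂ) * Complex.I) • 1
  have hB : ∀ t s : ℝ, |s - t| < c⁻¹ → IsUnit (B t) → IsUnit (B s) := by
    rintro t s hts ⟨u, hu⟩
    rcases subsingleton_or_nontrivial (StdModule A) with _ | _
    · exact isUnit_of_subsingleton _
    have hinv : ‖(↑u⁻¹ : StdModule A →L[ℂ] StdModule A)‖ ≤ c := by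
      refine ContinuousLinearMap.opNorm_le_bound _ hc.le fun x => ?_
      refine (h _).trans ?_
      gcongr
      refine (norm_le_norm_add_I_smul hS t _).trans (le_of_eq ?_)
      have : B t ((↑u⁻¹ : StdModule A →L[ℂ] StdModule A) x) = x := by
        rw [← hu]
        exact DFunLike.congr_fun u.mul_inv x
      exact congrArg norm this
    have hd : ‖B s - u‖ < ‖(↑u⁻¹ : StdModule A →L[ℂ] StdModule A)‖⁻¹ := by
      have h1 : B s - u = (((s - t : ℝ) : ℂ) * Complex.I) • 1 := by
        rw [hu]
        simp only [B, Complex.ofReal_sub]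
        module
      have h2 : ‖B s - u‖ < c⁻¹ := by
        rw [h1, norm_smul]
        refine lt_of_le_of_lt (mul_le_of_le_one_right (norm_nonneg _)
          ContinuousLinearMap.norm_id_le) ?_
        rwa [norm_mul, Complex.norm_real, Complex.norm_I, mul_one, Real.norm_eq_abs]
      exact h2.trans_le (inv_anti₀ (Units.norm_pos _) hinv)
    exact ⟨Units.ofNearby u (B s) hd, rfl⟩
  have hlarge : ∀ t : ℝ, ‖S‖ < t → IsUnit (B t) := by
    intro t ht
    rcases subsingleton_or_nontrivial (StdModule A) with _ | _
    · exact isUnit_of_subsingleton _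
    have h1 : (-((t : ℂ) * Complex.I)) ∈ resolventSet ℂ S := by
      refine spectrum.mem_resolventSet_of_norm_lt ?_
      simpa using ht.trans_le (le_abs_self t)
    have h2 := (spectrum.mem_resolventSet_iff.1 h1).neg
    convert h2 using 1
    simp only [B, Algebra.algebraMap_eq_smul_one]
    module
  -- The step is `c⁻¹ / 2` because `hB` needs a distance strictly below `c⁻¹`.
  have hstep : ∀ k : ℕ, ∀ t : ℝ, ‖S‖ < t + k * (c⁻¹ / 2) → IsUnit (B t) := by
    intro k
    induction k with
    | zero => intro t ht; exact hlarge t (by simpa using ht)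
    | succ k ih =>
      intro t ht
      refine hB (t + c⁻¹ / 2) t ?_ (ih _ ?_)
      · have : 0 < c⁻¹ := inv_pos.2 hc
        rw [sub_add_cancel_left, abs_neg, abs_of_pos (by positivity)]
        linarith
      · push_cast at ht
        linarith
  obtain ⟨k, hk⟩ := exists_nat_gt (‖S‖ / (c⁻¹ / 2))
  have h0 := hstep k 0 (by rw [zero_add]; rwa [div_lt_iff₀ (by positivity)] at hk)
  simpa [B] using h0

end StdModule

open StdModule

namespace Adjointable

/-! ### From a finitely generated complement to a right inverse modulo compacts. -/

variable {A : Type*} [CStarAlgebra A]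

theorem sum_rankOne_apply {ι : Type*} (s : Finset ι) (f g : ι → StdModule A) (z : StdModule A) :
    (∑ j ∈ s, rankOne (f j) (g j) : Adjointable A).1 z =
      ∑ j ∈ s, MulOpposite.op (ip (g j) z) • f j := by
  rw [← Subalgebra.val_apply, map_sum, sum_apply]
  rfl

theorem sum_rankOne_mem_compacts {ι : Type*} (s : Finset ι) (f g : ι → StdModule A) :
    (∑ j ∈ s, rankOne (f j) (g j) : Adjointable A) ∈ compacts A :=
  Submodule.sum_mem _ fun _ _ => Submodule.le_topologicalClosure _
    (Submodule.subset_span ⟨_, _, rfl⟩)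

/-- If the range of `D` together with finitely many elements spans `H_A`, then `D` is right
invertible modulo compact operators. -/
theorem exists_rightInverse_mod_compacts {D : Adjointable A} {n : ℕ} {g : Fin n → StdModule A}
    (hg : ∀ y, ∃ x, ∃ a : Fin n → A, D.1 x + ∑ j, MulOpposite.op (a j) • g j = y) :
    ∃ F K : Adjointable A, K ∈ compacts A ∧ D * F = 1 + K := by
  let _ := CStarAlgebra.spectralOrder A
  have _ := CStarAlgebra.spectralOrderedRing A
  obtain ⟨Ds, hDs⟩ := D.2
  have hDs' : ∀ x y, ip (Ds x) y = ip x (D.1 y) := fun x y => by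
    rw [← star_ip, ← hDs, star_ip]
  let D' : Adjointable A := ⟨Ds, D.1, hDs'⟩
  let T : (StdModule A × (Fin n → A)) →L[ℂ] StdModule A :=
    { toFun := fun p => D.1 p.1 + ∑ j, MulOpposite.op (p.2 j) • g j
      map_add' := fun p q => by
        simp only [Prod.fst_add, Prod.snd_add, map_add, Pi.add_apply, MulOpposite.op_add,
          add_smul, Finset.sum_add_distrib]
        abel
      map_smul' := fun c p => by
        simp only [Prod.smul_fst, Prod.smul_snd, map_smul, Pi.smul_apply, MulOpposite.op_smul,
          smul_assoc, RingHom.id_apply, smul_add, Finset.smul_sum]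
      cont := by fun_prop }
  -- Open mapping theorem: preimages under `T` can be chosen with norm at most `C ‖y‖`.
  obtain ⟨C, hC, hT⟩ := T.exists_preimage_norm_le fun y => by
    obtain ⟨x, a, h⟩ := hg y
    exact ⟨(x, a), h⟩
  let G : Adjointable A := ∑ j, rankOne (g j) (g j)
  -- This is `T T*`.
  let S : Adjointable A := D * D' + G
  have hSapply : ∀ y, S.1 y = D.1 (Ds y) + ∑ j, MulOpposite.op (ip (g j) y) • g j := fun y => by
    rw [← sum_rankOne_apply]
    rfl
  have hip : ∀ x y, ip x (S.1 y) = ip (Ds x) (Ds y) + ∑ j, ip x (g j) * ip (g j) y := by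
    intro x y
    rw [hSapply, ip_add_right, ip_sum_right, hDs']
    simp only [ip_op_smul_right, MulOpposite.unop_op]
  have hsymm : ∀ x y, ip (S.1 x) y = ip x (S.1 y) := by
    intro x y
    rw [← star_ip, hip, hip, star_add, star_ip, star_sum]
    simp only [star_mul, star_ip]
  have hterm : ∀ (j : Fin n) (y : StdModule A),
      ip y (g j) * ip (g j) y = star (ip (g j) y) * ip (g j) y := fun j y => by rw [star_ip]
  have hnn : ∀ (j : Fin n) (y : StdModule A), 0 ≤ ip y (g j) * ip (g j) y := fun j y => by
    rw [hterm]
    exact star_mul_self_nonneg _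
  have hb1 : ∀ y, ‖Ds y‖ ^ 2 ≤ ‖y‖ * ‖S.1 y‖ := fun y => by
    refine (norm_le_of_ip_self_le ?_).trans (norm_ip_le y (S.1 y))
    rw [hip]
    exact le_add_of_nonneg_right (Finset.sum_nonneg fun j _ => hnn j y)
  have hb2 : ∀ j y, ‖ip (g j) y‖ ^ 2 ≤ ‖y‖ * ‖S.1 y‖ := fun j y => by
    rw [sq, ← CStarRing.norm_star_mul_self, ← hterm]
    refine (CStarAlgebra.norm_le_norm_of_nonneg_of_le (hnn j y) ?_).trans (norm_ip_le y (S.1 y))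
    rw [hip]
    exact (Finset.single_le_sum (fun j _ => hnn j y) (Finset.mem_univ j)).trans
      (le_add_of_nonneg_left (ip_self_nonneg _))
  -- Write `y = T (x, a)` with `‖(x, a)‖ ≤ C ‖y‖` and expand `⟨y, y⟩ = ⟨y, T (x, a)⟩`. Each of the
  -- `1 + n` terms is at most `r C ‖y‖`, where `r² = ‖y‖ ‖S y‖`; cancel `‖y‖`, square, and cancel
  -- once more.
  have hbelow : ∀ y, ‖y‖ ≤ (C * (1 + n)) ^ 2 * ‖S.1 y‖ := by
    intro y
    set r := √(‖y‖ * ‖S.1 y‖) with hr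
    have hr2 : r ^ 2 = ‖y‖ * ‖S.1 y‖ := Real.sq_sqrt (by positivity)
    obtain ⟨⟨x, a⟩, hxa, hxa'⟩ := hT y
    have hx : ‖x‖ ≤ C * ‖y‖ := (norm_fst_le (x, a)).trans hxa'
    have ha : ∀ j, ‖a j‖ ≤ C * ‖y‖ := fun j =>
      (norm_le_pi_norm a j).trans ((norm_snd_le (x, a)).trans hxa')
    have h1 : ip y y = ip (Ds y) x + ∑ j, ip y (g j) * a j := by
      have h : ip y y = ip y (D.1 x + ∑ j, MulOpposite.op (a j) • g j) :=
        congrArg (ip y) hxa.symm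
      rw [h, ip_add_right, ip_sum_right, hDs']
      simp only [ip_op_smul_right, MulOpposite.unop_op]
    have h2 : ‖y‖ ^ 2 ≤ r * (C * ‖y‖) + ∑ _j : Fin n, r * (C * ‖y‖) := by
      rw [norm_sq_eq, h1]
      refine (norm_add_le _ _).trans (add_le_add ?_ (norm_sum_le_of_le _ fun j _ => ?_))
      · refine (norm_ip_le _ _).trans ?_
        gcongr
        exact Real.le_sqrt_of_sq_le (hb1 y)
      · refine (norm_mul_le _ _).trans ?_
        gcongr
        · rw [← star_ip, norm_star]
          exact Real.le_sqrt_of_sq_le (hb2 j y)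
        · exact ha j
    rw [Finset.sum_const, Finset.card_univ, Fintype.card_fin, nsmul_eq_mul] at h2
    rcases (norm_nonneg y).eq_or_lt with hy | hy
    · rw [← hy]
      positivity
    have h3 : ‖y‖ ≤ C * (1 + n) * r := by
      refine le_of_mul_le_mul_right ?_ hy
      linarith
    have h4 : ‖y‖ ^ 2 ≤ (C * (1 + n)) ^ 2 * (‖y‖ * ‖S.1 y‖) := by
      rw [← hr2, ← mul_pow]
      gcongr
    refine le_of_mul_le_mul_left ?_ hy
    linarith
  obtain ⟨u, hu⟩ := isUnit_of_symmetric_of_bounded_below hsymm (by positivity) hbelow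
  have hright : ∀ x, S.1 ((↑u⁻¹ : StdModule A →L[ℂ] StdModule A) x) = x := fun x => by
    rw [← hu]
    exact DFunLike.congr_fun u.mul_inv x
  -- The inverse of a symmetric operator is symmetric, so it is its own adjoint.
  let R : Adjointable A := ⟨↑u⁻¹, ↑u⁻¹, fun x y => by
    conv_lhs => rw [← hright y]
    rw [← hsymm, hright]⟩
  have hSR : S * R = 1 := Subtype.ext (ContinuousLinearMap.ext hright)
  refine ⟨D' * R, -(G * R), neg_mem (mul_mem_compacts_right R (sum_rankOne_mem_compacts _ g g)),
    ?_⟩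
  rw [← hSR, add_mul, mul_assoc]
  abel

/-- The summand `M₂` lies in the range of `D`, and generators of `N₂` supply the finitely many extra
elements. -/
theorem IsLowerSemiFredholm.exists_rightInverse_mod_compacts {D : Adjointable A}
    (h : IsLowerSemiFredholm D) :
    ∃ F K : Adjointable A, K ∈ compacts A ∧ D * F = 1 + K := by
  obtain ⟨M₁, N₁, M₂, N₂, -, -, -, -, -, h₂, ⟨e, he⟩, -, hfg⟩ := h
  obtain ⟨n, g, hg⟩ := Submodule.fg_iff_exists_fin_generating_family.1 hfg
  refine Adjointable.exists_rightInverse_mod_compacts (g := g) fun y => ?_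
  obtain ⟨m, hm, k, hk, rfl⟩ := Submodule.mem_sup.1 (h₂.sup_eq_top ▸ Submodule.mem_top (x := y))
  rw [← hg] at hk
  obtain ⟨a, rfl⟩ := (Submodule.mem_span_range_iff_exists_fun _).1 hk
  refine ⟨e.symm ⟨m, hm⟩, fun j => (a j).unop, ?_⟩
  rw [← he, e.apply_symm_apply]
  simp

/-! ### From a right inverse modulo compacts to the decompositions. -/

/-- Tails of compact operators tend to zero in norm. -/
theorem tendsto_norm_tail_mul {K : Adjointable A}
    (hK : K ∈ Submodule.span ℂ {T | ∃ x y : StdModule A, T = rankOne x y}) :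
    Tendsto (fun n => ‖tailCLM A n * K.1‖) atTop (𝓝 0) := by
  induction hK using Submodule.span_induction with
  | mem L h =>
    obtain ⟨x, y, rfl⟩ := h
    have h1 := ((tendsto_tail x).norm).mul_const ‖y‖
    rw [norm_zero, zero_mul] at h1
    refine squeeze_zero (fun _ => norm_nonneg _) (fun n => ?_) h1
    -- `P θ_{x,y} = θ_{P x, y}`, so only the tail of the single vector `x` matters.
    have h2 : tailCLM A n * (rankOne x y).1 = rankOneCLM (tail n x) y :=
      ContinuousLinearMap.ext fun z => tailCLM_op_smul n _ x
    rw [h2]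
    exact LinearMap.mkContinuous_norm_le _ (by positivity) _
  | zero => simp
  | add L M _ _ h1 h2 =>
    refine squeeze_zero (fun _ => norm_nonneg _) (fun n => ?_) (by simpa using h1.add h2)
    rw [Subalgebra.coe_add, mul_add]
    exact norm_add_le _ _
  | smul c L _ h =>
    refine squeeze_zero (fun _ => norm_nonneg _) (fun n => ?_) (by simpa using h.const_mul ‖c‖)
    rw [Subalgebra.coe_smul, mul_smul_comm, norm_smul]

/-- Tail projections are contractions, so approximating `K` within `1 / 2` by a combination of
`θ_{x,y}` costs less than `1 / 2`. -/
theorem exists_norm_tail_mul_lt_one {K : Adjointable A} (hK : K ∈ compacts A) :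
    ∃ n, ‖tailCLM A n * K.1‖ < 1 := by
  obtain ⟨L, hL, hKL⟩ := Metric.mem_closure_iff.1 hK (1 / 2) (by norm_num)
  obtain ⟨n, hn⟩ := ((tendsto_norm_tail_mul hL).eventually_lt_const
    (show (0 : ℝ) < 1 / 2 by norm_num)).exists
  refine ⟨n, ?_⟩
  have h1 : tailCLM A n * K.1 = tailCLM A n * (K.1 - L.1) + tailCLM A n * L.1 := by
    rw [mul_sub, sub_add_cancel]
  have h2 : ‖K.1 - L.1‖ < 1 / 2 := by
    rw [dist_eq_norm] at hKL
    exact hKL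
  have h3 : ‖tailCLM A n * (K.1 - L.1)‖ ≤ 1 * ‖K.1 - L.1‖ :=
    (norm_mul_le _ _).trans (by gcongr; exact norm_tailCLM_le n)
  rw [h1]
  refine (norm_add_le _ _).trans_lt ?_
  linarith

/-- If the compression of `D` to a tail of `H_A` has a bounded `A`-linear right inverse `R` then
`D` is lower semi-Fredholm. -/
theorem isLowerSemiFredholm_of_tail {D : Adjointable A} {n : ℕ}
    {R : StdModule A →L[ℂ] StdModule A} (hR : ∀ (a : Aᵐᵒᵖ) x, R (a • x) = a • R x)
    (hRP : ∀ x, R (tail n x) = R x) (hPDR : ∀ x, tail n (D.1 (R x)) = tail n x) :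
    IsLowerSemiFredholm D := by
  -- Makes `R D` and `D R` idempotent.
  have hRDR : ∀ x, R (D.1 (R x)) = R x := fun x => by rw [← hRP, hPDR, hRP]
  let P : StdModule A →ₗ[Aᵐᵒᵖ] StdModule A :=
    { toFun := tail n, map_add' := (tailCLM A n).map_add, map_smul' := tailCLM_op_smul n }
  let D' : StdModule A →ₗ[Aᵐᵒᵖ] StdModule A :=
    { toFun := D.1, map_add' := D.1.map_add, map_smul' := map_op_smul D }
  let R' : StdModule A →ₗ[Aᵐᵒᵖ] StdModule A :=
    { toFun := R, map_add' := R.map_add, map_smul' := hR }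
  have hPc : Continuous (tail n : StdModule A → StdModule A) := (tailCLM A n).continuous
  have hRc : Continuous R := R.continuous
  have hDc : Continuous D.1 := D.1.continuous
  -- Ranges of the idempotents `R D` and `D R`, taken as fixed-point sets so that closedness is
  -- immediate. Their kernels are `ker (P D)` and `ker P`.
  let M₁ := LinearMap.eqLocus (R' ∘ₗ D') LinearMap.id
  let M₂ := LinearMap.eqLocus (D' ∘ₗ R') LinearMap.id
  have hM₁ : ∀ {x}, x ∈ M₁ ↔ R (D.1 x) = x := Iff.rfl
  have hM₂ : ∀ {x}, x ∈ M₂ ↔ D.1 (R x) = x := Iff.rfl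
  have hN₁ : ∀ {x}, x ∈ (P ∘ₗ D').ker ↔ tail n (D.1 x) = 0 := Iff.rfl
  have hN₂ : ∀ {x}, x ∈ P.ker ↔ tail n x = 0 := Iff.rfl
  have hR0 : ∀ {x}, tail n x = 0 → R x = 0 := fun h => by rw [← hRP, h, map_zero]
  have hP : ∀ x y, tail n (x - y) = tail n x - tail n y := (tailCLM A n).map_sub
  refine ⟨M₁, (P ∘ₗ D').ker, M₂, P.ker, isClosed_eq (hRc.comp hDc) continuous_id,
    isClosed_eq (hPc.comp hDc) continuous_const, isClosed_eq (hDc.comp hRc) continuous_id,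
    isClosed_eq hPc continuous_const, ⟨?_, ?_⟩, ⟨?_, ?_⟩, ⟨?_, ?_⟩, fun x hx => hx, ?_⟩
  · rw [Submodule.disjoint_def]
    intro x h1 h2
    rw [← hM₁.1 h1, hR0 (hN₁.1 h2)]
  · rw [codisjoint_iff_le_sup]
    intro x _
    refine Submodule.mem_sup.2 ⟨R (D.1 x), hM₁.2 (hRDR _), x - R (D.1 x), hN₁.2 ?_,
      add_sub_cancel _ _⟩
    rw [map_sub, hP, hPDR, sub_self]
  · rw [Submodule.disjoint_def]
    intro x h1 h2
    rw [← hM₂.1 h1, hR0 (hN₂.1 h2), map_zero]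
  · rw [codisjoint_iff_le_sup]
    intro x _
    refine Submodule.mem_sup.2 ⟨D.1 (R x), hM₂.2 (by rw [hRDR]), x - D.1 (R x), hN₂.2 ?_,
      add_sub_cancel _ _⟩
    rw [hP, hPDR, sub_self]
  · exact
      { toFun := fun x => ⟨D.1 x, hM₂.2 (by rw [hM₁.1 x.2])⟩
        map_add' := fun x y => Subtype.ext (D.1.map_add x y)
        map_smul' := fun a x => Subtype.ext (map_op_smul D a x)
        invFun := fun x => ⟨R x, hM₁.2 (by rw [hM₂.1 x.2])⟩
        left_inv := fun x => Subtype.ext (hM₁.1 x.2)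
        right_inv := fun x => Subtype.ext (hM₂.1 x.2)
        continuous_toFun := (hDc.comp continuous_subtype_val).subtype_mk _
        continuous_invFun := (hRc.comp continuous_subtype_val).subtype_mk _ }
  · exact fun x => rfl
  · have h : P.ker = Submodule.span Aᵐᵒᵖ (single A '' Set.Iio n) := by
      refine le_antisymm (fun x hx => ?_) (Submodule.span_le.2 ?_)
      · rw [eq_sum_of_tail_eq_zero (hN₂.1 hx)]
        exact Submodule.sum_mem _ fun i hi => Submodule.smul_mem _ _
          (Submodule.subset_span ⟨i, Finset.mem_range.1 hi, rfl⟩)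
      · rintro _ ⟨i, hi, rfl⟩
        exact tail_single hi
    rw [h]
    exact Submodule.fg_span ((Set.finite_Iio n).image _)

theorem isLowerSemiFredholm_of_mul_eq {D F K : Adjointable A} (hK : K ∈ compacts A)
    (h : D * F = 1 + K) : IsLowerSemiFredholm D := by
  obtain ⟨n, hn⟩ := exists_norm_tail_mul_lt_one hK
  -- `V = 1 + P K`, inverted by the Neumann series.
  let V := Units.oneSub (-(tailCLM A n * K.1)) (by rwa [norm_neg])
  have hV : ∀ x, (V : StdModule A →L[ℂ] StdModule A) x = x + tail n (K.1 x) := fun x => by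
    simp only [V, Units.val_oneSub, sub_neg_eq_add]
    rfl
  let W : StdModule A →L[ℂ] StdModule A := ↑V⁻¹
  have hVW : ∀ x, W x + tail n (K.1 (W x)) = x := fun x => by
    rw [← hV]
    exact DFunLike.congr_fun V.mul_inv x
  have hWV : ∀ x, W (x + tail n (K.1 x)) = x := fun x => by
    rw [← hV]
    exact DFunLike.congr_fun V.inv_mul x
  -- `W` inherits `A`-linearity from its inverse `1 + P K`.
  have hW : ∀ (a : Aᵐᵒᵖ) x, W (a • x) = a • W x := fun a x => by
    conv_lhs => rw [← hVW x]
    rw [smul_add, ← tailCLM_apply, ← tailCLM_op_smul, tailCLM_apply, ← map_op_smul K, hWV]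
  have hDF : ∀ x, D.1 (F.1 x) = x + K.1 x := fun x => by
    simpa using DFunLike.congr_fun (congrArg Subtype.val h) x
  have hadd : ∀ x y : StdModule A, tail n (x + y) = tail n x + tail n y := (tailCLM A n).map_add
  have hidem : ∀ x : StdModule A, tail n (tail n x) = tail n x := tailCLM_idem n
  -- With `R = F W P`: `P D R = P (1 + K) W P = P (1 + P K) W P = P`, using `P² = P`.
  refine isLowerSemiFredholm_of_tail (n := n) (R := F.1 * W * tailCLM A n) (fun a x => ?_)
    (fun x => ?_) (fun x => ?_)
  · change F.1 (W (tailCLM A n _)) = a • F.1 (W (tailCLM A n x))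
    rw [tailCLM_op_smul, hW, map_op_smul F]
  · change F.1 (W (tail n (tail n x))) = F.1 (W (tail n x))
    rw [hidem]
  · change tail n (D.1 (F.1 (W (tail n x)))) = _
    rw [hDF, hadd, ← hidem (K.1 _), ← hadd, hVW, hidem]

end Adjointable

end HilbertMod

theorem theorem2p3 {A : Type*} [CStarAlgebra A] (D : HilbertMod.Adjointable A) :
    List.TFAE [
      HilbertMod.Adjointable.IsLowerSemiFredholm D,
      ∃ F K : HilbertMod.Adjointable A, K ∈ HilbertMod.Adjointable.compacts A ∧ D * F = 1 + K,
      ∃ C : HilbertMod.Adjointable.Calkin A, HilbertMod.Adjointable.toCalkin A D * C = 1] := by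
  tfae_have 1 → 2 := fun h => h.exists_rightInverse_mod_compacts
  tfae_have 2 → 1 := fun ⟨F, K, hK, h⟩ => HilbertMod.Adjointable.isLowerSemiFredholm_of_mul_eq hK h
  tfae_have 2 → 3 := by
    rintro ⟨F, K, hK, h⟩
    refine ⟨HilbertMod.Adjointable.toCalkin A F, ?_⟩
    have hK0 : HilbertMod.Adjointable.toCalkin A K = 0 := Ideal.Quotient.eq_zero_iff_mem.2 hK
    rw [← map_mul, h, map_add, hK0, map_one, add_zero]
  tfae_have 3 → 2 := by
    rintro ⟨C, hC⟩
    obtain ⟨F, rfl⟩ := Ideal.Quotient.mk_surjective C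
    exact ⟨F, D * F - 1, Ideal.Quotient.eq.1 hC, (add_sub_cancel _ _).symm⟩
  tfae_finish
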